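/- Consider finite-state automata placed on the nodes of a finite set $C\subset\mathbb Z^2$ (a configuration), exactly one node of which is designated as the general. Each copy receives as inputs, from the east, north, west and south, the current states of the adjacent nodes, or a special signal $\#$ where there is no node, and all copies update synchronously by one transition function. An automaton has a quiescent state $\mathrm Q$, such that a node in state $\mathrm Q$ all of whose inputs are $\mathrm Q$ or $\#$ remains in $\mathrm Q$. At time $0$ all nodes except the general are in $\mathrm Q$. In the traditional model the general starts in a state $\mathrm G$ and there is one firing state $\mathrm F$, where $\mathrm Q,\mathrm G,\mathrm F$ are distinct. In the boundary sensitive model the initial state of the general is a non-quiescent state that may depend on which of the four positions adjacent to the general belong to $C$, and there is a set of firing states, not containing $\mathrm Q$ (initial states of the general may belong to it). A variation $\Gamma$ of the firing squad synchronization problem is a set of configurations with a designated general. In either model, a solution of $\Gamma$ is an automaton $A$ such that for every $C\in\Gamma$ there is a time $\mathrm{ft}(C,A)$ at which all nodes of $C$ are in a firing state and before which no node of $C$ is in a firing state. The minimum firing time $\mathrm{mft}_\Gamma(C)$ is the minimum of $\mathrm{ft}(C,A)$ over all solutions $A$ of $\Gamma$ in the model considered, and a minimal-time solution is a solution $\tilde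 A$ with $\mathrm{ft}(C,\tilde A)=\mathrm{mft}_\Gamma(C)$ for all $C\in\Gamma$. For positive integers $a,b$ let $\text{g-LSP}[a,b]$ be the variation whose configurations are the L-shaped paths $$\{(i,0): 0\le i\le al\}\cup\{(al,j): 0\le j\le bl\},\qquad l\ge 1,$$ with the general at an arbitrary node. Theorem. For all positive integers $a,b$, the variation $\text{g-LSP}[a,b]$ has no minimal-time solution, in the traditional model as well as in the boundary sensitive model. -/

import Mathlib

/-!
Variations of the firing squad synchronization problem (FSSP) in the two-dimensional grid `ℤ × ℤ`:
configurations, finite automata in the traditional and in the boundary sensitive model, solutions,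
firing times, minimum firing times, minimal-time solutions, and the variation `g-LSP[a,b]`.
-/

namespace FSSP

/-- Positions of the two-dimensional grid space. -/
abbrev Pos : Type := ℤ × ℤ

/-- The four unit vectors: east, north, west, south. -/
def dir : Fin 4 → Pos := ![(1, 0), (0, 1), (-1, 0), (0, -1)]

/-- A configuration: a finite set of grid positions (the nodes), one of which is the general. -/
structure Configuration where
  cells : Finset Pos
  gen : Pos
  gen_mem : gen ∈ cells

/-- The boundary condition of `v` in `C`: which of the four adjacent positions are nodes of `C`. -/
def Configuration.bc (C : Configuration) (v : Pos) : Fin 4 → Bool :=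
  fun i => decide (v + dir i ∈ C.cells)

/-- The two models of FSSP. -/
inductive Model where
  | traditional
  | boundarySensitive

/-- A finite automaton of the boundary sensitive model (traditional automata are the special case
`Automaton.InModel .traditional` below). Its four inputs come from the east, north, west and south;
the input is `none` (the signal `#`) if there is no node in that direction, and otherwise `some` of
the state of the adjacent node. `general b` is the state at time `0` of a general whose boundary
condition is `b`, that is, `G_{η(b)}`. -/
structure Automaton where
  State : Type
  finite : Finite State
  quiescent : State
  general : (Fin 4 → Bool) → State
  firing : Set State
  next : State → (Fin 4 → Option State) → State
  next_quiescent : ∀ inputs : Fin 4 → Option State,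
    (∀ i, inputs i = none ∨ inputs i = some quiescent) → next quiescent inputs = quiescent
  general_ne_quiescent : ∀ b, general b ≠ quiescent
  quiescent_notMem_firing : quiescent ∉ firing

/-- `A` is an automaton of the model `M`. In the traditional model there is one general state `G`,
used whatever the boundary condition is, and one firing state `F`, and `G`, `F` and the quiescent
state are three different states. -/
def Automaton.InModel (A : Automaton) : Model → Prop
  | .traditional => ∃ G F : A.State, G ≠ F ∧ (∀ b, A.general b = G) ∧ A.firing = {F}
  | .boundarySensitive => True

/-- `A.st C t v` is the state at time `t` of the node `v` of `C` when all nodes of `C` are copies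
of `A` (it has no meaning for `v ∉ C.cells` and is never used there). -/
def Automaton.st (A : Automaton) (C : Configuration) : ℕ → Pos → A.State
  | 0, v => if v = C.gen then A.general (C.bc C.gen) else A.quiescent
  | t + 1, v => A.next (A.st C t v)
      (fun i => if v + dir i ∈ C.cells then some (A.st C t (v + dir i)) else none)

/-- All nodes of `C` enter a firing state at time `t`, and no node does so before. -/
def Automaton.FiresAt (A : Automaton) (C : Configuration) (t : ℕ) : Prop :=
  (∀ s < t, ∀ v ∈ C.cells, A.st C s v ∉ A.firing) ∧ ∀ v ∈ C.cells, A.st C t v ∈ A.firing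

/-- The firing time `ft(C, A)`; it is the unique `t` with `A.FiresAt C t` whenever there is one
(`Automaton.FiresAt.ft_eq`). -/
noncomputable def Automaton.ft (A : Automaton) (C : Configuration) : ℕ :=
  sInf {t | A.FiresAt C t}

theorem Automaton.FiresAt.ft_eq {A : Automaton} {C : Configuration} {t : ℕ}
    (h : A.FiresAt C t) : A.ft C = t := by
  refine le_antisymm (Nat.sInf_le h) (not_lt.mp fun hlt => ?_)
  have h2 : A.FiresAt C (A.ft C) := Nat.sInf_mem (s := {t | A.FiresAt C t}) ⟨t, h⟩
  exact h.1 _ hlt _ C.gen_mem (h2.2 _ C.gen_mem)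

/-- A variation of FSSP: the set of its configurations. -/
abbrev Variation : Type := Set Configuration

/-- `A` is a solution of the variation `Γ` in the model `M`. -/
def IsSolution (M : Model) (Γ : Variation) (A : Automaton) : Prop :=
  A.InModel M ∧ ∀ C ∈ Γ, ∃ t, A.FiresAt C t

/-- The minimum firing time of `C`: the minimum of `ft(C, A)` over all solutions `A` of `Γ`
in the model `M`. -/
noncomputable def mft (M : Model) (Γ : Variation) (C : Configuration) : ℕ :=
  sInf {t | ∃ A, IsSolution M Γ A ∧ A.ft C = t}

/-- A minimal-time solution fires every configuration of `Γ` at its minimum firing time. -/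
def IsMinimalTimeSolution (M : Model) (Γ : Variation) (A : Automaton) : Prop :=
  IsSolution M Γ A ∧ ∀ C ∈ Γ, A.ft C = mft M Γ C

/-- The nodes of the L-shaped path with west terminal `(0, 0)`, (southeast) corner `(w, 0)` and
north terminal `(w, h)`. -/
def lPath (w h : ℕ) : Finset Pos :=
  (Finset.range (w + 1)).image (fun i : ℕ => ((i : ℤ), (0 : ℤ))) ∪
    (Finset.range (h + 1)).image (fun j : ℕ => ((w : ℤ), (j : ℤ)))

/-- The variation `g-LSP[a,b]`: L-shaped paths whose horizontal and vertical arms have lengths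
`a * l` and `b * l` for some `l ≥ 1`, the general being any one of the nodes. -/
def gLSP (a b : ℕ) : Variation :=
  {C | ∃ l : ℕ, 1 ≤ l ∧ C.cells = lPath (a * l) (b * l)}

end FSSP

/-! Put the general at the west terminal of the path with arms w = al and h = bl, so that its wave
reaches the north terminal at time w + h. Assume a ≤ b; the other case follows from the reflection
that exchanges the arms (`Automaton.flip`).

Each single path can be fired by time w + h + 1. Within the variation w determines l, so a node
recognizes the path once it knows that the general is at the west terminal and the corner at
distance w, and for w ≤ h this news reaches every node by time w + h + 1. The automaton `scout`,
with w and the firing time built in, fires on this evidence and never on another configuration of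
the variation, so racing it against any solution gives a solution (`IsSolution.exists_ft_le`). A
minimal-time solution would therefore fire all these paths by time w + h + 1.

No single automaton does so (`Automaton.lt_of_firesAt`). Past the corner, the four cells at the
front of the wave evolve on their own, as a finite system, hence become periodic until the north
terminal interferes. If h is large and all nodes fire at some t ≤ w + h + 1, one of those four cells
fires without any influence of the terminal, and periodicity yields a node that fired before t. -/

namespace FSSP

/-! ### Geometry of L-shaped paths -/

theorem mem_lPath {w h : ℕ} {v : Pos} :
    v ∈ lPath w h ↔ (0 ≤ v.1 ∧ v.1 ≤ w ∧ v.2 = 0) ∨ (v.1 = w ∧ 0 ≤ v.2 ∧ v.2 ≤ h) := by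
  obtain ⟨x, y⟩ := v
  simp only [lPath, Finset.mem_union, Finset.mem_image, Finset.mem_range, Prod.mk.injEq]
  constructor
  · rintro (⟨i, hi, rfl, rfl⟩ | ⟨i, hi, rfl, rfl⟩)
    · left; omega
    · right; omega
  · rintro (⟨h0, h1, h2⟩ | ⟨h0, h1, h2⟩)
    · exact Or.inl ⟨x.toNat, by omega, by omega, by omega⟩
    · exact Or.inr ⟨y.toNat, by omega, by omega, by omega⟩

/-- The `i`-th node of an L-shaped path with horizontal arm of length `w`, counted from the west
terminal. -/
def lNode (w i : ℕ) : Pos := (((min i w : ℕ) : ℤ), ((i - w : ℕ) : ℤ))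

theorem lNode_mem {w h i : ℕ} (hi : i ≤ w + h) : lNode w i ∈ lPath w h := by
  simp only [mem_lPath, lNode]
  omega

theorem exists_lNode_eq {w h : ℕ} {v : Pos} (hv : v ∈ lPath w h) :
    ∃ i ≤ w + h, lNode w i = v := by
  obtain ⟨x, y⟩ := v
  simp only [mem_lPath] at hv
  refine ⟨(x + y).toNat, by omega, ?_⟩
  simp only [lNode, Prod.mk.injEq]
  omega

/-- The L-shaped path with the general at the west terminal. -/
def lConf (w h : ℕ) : Configuration where
  cells := lPath w h
  gen := (0, 0)
  gen_mem := by simp [mem_lPath]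

theorem lNode_succ_adj (w i : ℕ) :
    (∃ d, lNode w (i + 1) + dir d = lNode w i) ∧ ∃ d, lNode w i + dir d = lNode w (i + 1) := by
  by_cases h : i < w
  · refine ⟨⟨2, ?_⟩, ⟨0, ?_⟩⟩ <;> ext <;> simp [lNode, dir] <;> omega
  · refine ⟨⟨3, ?_⟩, ⟨1, ?_⟩⟩ <;> ext <;> simp [lNode, dir] <;> omega

theorem lConf_bc_gen {w h : ℕ} (hw : 0 < w) (i : Fin 4) :
    (0, 0) + dir i ∈ lPath w h ↔ i = 0 := by
  fin_cases i <;> simp [mem_lPath, dir] <;> omega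

theorem lConf_bc_corner {w h : ℕ} (hw : 0 < w) (hh : 0 < h) (i : Fin 4) :
    lNode w w + dir i ∈ lPath w h ↔ i = 1 ∨ i = 2 := by
  fin_cases i <;> simp [mem_lPath, dir, lNode] <;> omega

theorem eq_zero_of_bc_east {w h : ℕ} {v : Pos} (hv : v ∈ lPath w h)
    (hb : ∀ i, v + dir i ∈ lPath w h ↔ i = 0) : v = (0, 0) := by
  obtain ⟨x, y⟩ := v
  have h0 := hb 0
  have h1 := hb 1
  have h2 := hb 2
  have h3 := hb 3
  simp [mem_lPath, dir] at h0 h1 h2 h3 hv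
  simp only [Prod.mk.injEq]
  omega

theorem eq_corner_of_bc {w h : ℕ} {v : Pos}
    (hb : ∀ i, v + dir i ∈ lPath w h ↔ i = 1 ∨ i = 2) : v = ((w : ℤ), 0) := by
  obtain ⟨x, y⟩ := v
  have h1 := hb 1
  have h2 := hb 2
  simp [mem_lPath, dir] at h1 h2
  simp only [Prod.mk.injEq]
  omega

theorem Configuration.eq_of_cells_of_gen {C D : Configuration} (h : C.cells = D.cells)
    (hg : C.gen = D.gen) : C = D := by
  cases C; cases D; simp_all

/-! ### Propagation -/

theorem abs_dir (i : Fin 4) : |(dir i).1| + |(dir i).2| = 1 := by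
  fin_cases i <;> simp [dir]

/-- Nothing is known at time `t` beyond distance `t` from the general. -/
theorem Automaton.st_eq_quiescent (A : Automaton) (C : Configuration) (t : ℕ) (v : Pos)
    (h : (t : ℤ) < |v.1 - C.gen.1| + |v.2 - C.gen.2|) : A.st C t v = A.quiescent := by
  induction t generalizing v with
  | zero =>
    have : v ≠ C.gen := by rintro rfl; simp at h
    simp [Automaton.st, this]
  | succ t ih =>
    push_cast at h
    rw [Automaton.st, ih v (by omega)]
    refine A.next_quiescent _ fun i => ?_
    by_cases hm : v + dir i ∈ C.cells
    · right
      rw [if_pos hm, ih]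
      have h1 := abs_dir i
      have h2 : |v.1 - C.gen.1| ≤ |(v + dir i).1 - C.gen.1| + |(dir i).1| := by
        rw [Prod.fst_add]
        calc |v.1 - C.gen.1| = |(v.1 + (dir i).1 - C.gen.1) - (dir i).1| := by ring_nf
          _ ≤ _ := abs_sub _ _
      have h3 : |v.2 - C.gen.2| ≤ |(v + dir i).2 - C.gen.2| + |(dir i).2| := by
        rw [Prod.snd_add]
        calc |v.2 - C.gen.2| = |(v.2 + (dir i).2 - C.gen.2) - (dir i).2| := by ring_nf
          _ ≤ _ := abs_sub _ _
      omega
    · left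
      rw [if_neg hm]

theorem Automaton.st_lNode_eq_quiescent (A : Automaton) (w h : ℕ) {t i : ℕ} (hi : t < i) :
    A.st (lConf w h) t (lNode w i) = A.quiescent := by
  apply A.st_eq_quiescent
  simp only [lNode, lConf, sub_zero, Nat.abs_cast]
  omega

/-- A property of space-time points of an L-shaped path which persists in time and spreads to
adjacent nodes spreads along the path with unit speed. -/
theorem spread {w h : ℕ} {P : ℕ → Pos → Prop} (hself : ∀ t v, P t v → P (t + 1) v)
    (hadj : ∀ t v d, v + dir d ∈ lPath w h → P t (v + dir d) → P (t + 1) v)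
    {t₀ i₀ : ℕ} (h₀ : P t₀ (lNode w i₀)) (hi₀ : i₀ ≤ w + h) {t i : ℕ} (hi : i ≤ w + h)
    (hle : t₀ + i ≤ t + i₀) (hge : t₀ + i₀ ≤ t + i) : P t (lNode w i) := by
  induction t generalizing i with
  | zero =>
    obtain rfl : t₀ = 0 := by omega
    obtain rfl : i = i₀ := by omega
    exact h₀
  | succ t ih =>
    rcases lt_trichotomy i i₀ with hlt | rfl | hlt
    · obtain ⟨d, hd⟩ := (lNode_succ_adj w i).2
      refine hadj t _ d ?_ ?_
      · rw [hd]; exact lNode_mem (by omega)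
      · rw [hd]; exact ih (by omega) (by omega) (by omega)
    · rcases Nat.lt_or_ge t t₀ with ht | ht
      · obtain rfl : t₀ = t + 1 := by omega
        exact h₀
      · exact hself t _ (ih hi (by omega) (by omega))
    · obtain ⟨j, rfl⟩ : ∃ j, i = j + 1 := ⟨i - 1, by omega⟩
      obtain ⟨d, hd⟩ := (lNode_succ_adj w j).1
      refine hadj t _ d ?_ ?_
      · rw [hd]; exact lNode_mem (by omega)
      · rw [hd]; exact ih (by omega) (by omega) (by omega)

/-! ### Firing as soon as one of two automata fires -/

open Classical in
/-- The state of `A.race B` in which the two components are in states `x` and `y`. -/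
noncomputable def racePair (A B : Automaton) (x : A.State) (y : B.State) :
    Option (A.State × B.State) :=
  if x ∈ A.firing ∨ y ∈ B.firing then none else some (x, y)

/-- The automaton running `A` and `B` in parallel until one of them enters a firing state. -/
noncomputable def Automaton.race (A B : Automaton) : Automaton where
  State := Option (A.State × B.State)
  finite := by
    have := A.finite
    have := B.finite
    infer_instance
  quiescent := some (A.quiescent, B.quiescent)
  general b := racePair A B (A.general b) (B.general b)
  firing := {none}
  next s inputs := s.bind fun p =>
    racePair A B
      -- The default of `getD` stands in for a neighbor that has already fired. It is immaterial:
      -- the race is only followed up to the first firing.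
      (A.next p.1 fun i => (inputs i).map fun q => (q.getD (A.quiescent, B.quiescent)).1)
      (B.next p.2 fun i => (inputs i).map fun q => (q.getD (A.quiescent, B.quiescent)).2)
  next_quiescent inputs h := by
    simp only [Option.bind_some]
    rw [A.next_quiescent, B.next_quiescent, racePair, if_neg]
    · simp [A.quiescent_notMem_firing, B.quiescent_notMem_firing]
    · intro i
      rcases h i with h | h <;> simp [h]
    · intro i
      rcases h i with h | h <;> simp [h]
  general_ne_quiescent b := by
    unfold racePair
    split_ifs
    · simp
    · simp [A.general_ne_quiescent b]
  quiescent_notMem_firing := by simp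

theorem Automaton.race_st (A B : Automaton) (C : Configuration) (t : ℕ)
    (h : ∀ s < t, ∀ v ∈ C.cells, A.st C s v ∉ A.firing ∧ B.st C s v ∉ B.firing) :
    ∀ v ∈ C.cells, (A.race B).st C t v = racePair A B (A.st C t v) (B.st C t v) := by
  induction t with
  | zero =>
    intro v hv
    by_cases hg : v = C.gen
    · simp [Automaton.st, hg, Automaton.race]
    · simp [Automaton.st, hg, Automaton.race, racePair, A.quiescent_notMem_firing,
        B.quiescent_notMem_firing]
  | succ t ih =>
    intro v hv
    have key : ∀ u ∈ C.cells, (A.race B).st C t u = some (A.st C t u, B.st C t u) := by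
      intro u hu
      rw [ih (fun s hs => h s (by omega)) u hu, racePair, if_neg]
      have := h t (by omega) u hu
      tauto
    simp only [Automaton.st]
    rw [key v hv]
    simp only [Automaton.race, Option.bind_some]
    congr 2
    · funext i
      split_ifs with hm
      · have := key _ hm
        simp only [Automaton.race] at this
        simp [this]
      · rfl
    · funext i
      split_ifs with hm
      · have := key _ hm
        simp only [Automaton.race] at this
        simp [this]
      · rfl

theorem Automaton.race_firesAt {A B : Automaton} {C : Configuration} {t : ℕ}
    (h : ∀ s < t, ∀ v ∈ C.cells, A.st C s v ∉ A.firing ∧ B.st C s v ∉ B.firing)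
    (ht : ∀ v ∈ C.cells, A.st C t v ∈ A.firing ∨ B.st C t v ∈ B.firing) :
    (A.race B).FiresAt C t := by
  refine ⟨fun s hs v hv => ?_, fun v hv => ?_⟩
  · rw [A.race_st B C s (fun r hr => h r (by omega)) v hv]
    have := h s hs v hv
    rw [racePair, if_neg (by tauto)]
    exact Option.some_ne_none _
  · rw [A.race_st B C t h v hv, racePair, if_pos (ht v hv)]
    rfl

/-- A traditional race needs one non-firing initial state. For `A` this comes from G ≠ F; `B` need
not be traditional, only start in a constant non-firing state. -/
theorem Automaton.InModel.race {M : Model} {A B : Automaton} (hA : A.InModel M)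
    (hB : ∃ g, g ∉ B.firing ∧ ∀ b, B.general b = g) : (A.race B).InModel M := by
  cases M with
  | boundarySensitive => trivial
  | traditional =>
    obtain ⟨G, F, hne, hG, hF⟩ := hA
    obtain ⟨g, hg, hgb⟩ := hB
    refine ⟨some (G, g), none, Option.some_ne_none _, fun b => ?_, rfl⟩
    change racePair A B _ _ = _
    rw [hG, hgb, racePair, if_neg]
    simp [hF, hne, hg]

/-! ### Reflection -/

/-- The automaton with inputs east and south, and north and west, exchanged. -/
def Automaton.flip (A : Automaton) : Automaton where
  State := A.State
  finite := A.finite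
  quiescent := A.quiescent
  general b := A.general (b ∘ Fin.rev)
  firing := A.firing
  next s inputs := A.next s (inputs ∘ Fin.rev)
  next_quiescent _ h := A.next_quiescent _ fun i => h (Fin.rev i)
  general_ne_quiescent _ := A.general_ne_quiescent _
  quiescent_notMem_firing := A.quiescent_notMem_firing

theorem Automaton.InModel.flip {M : Model} {A : Automaton} (h : A.InModel M) :
    A.flip.InModel M := by
  cases M with
  | boundarySensitive => trivial
  | traditional =>
    obtain ⟨G, F, hne, hG, hF⟩ := h
    exact ⟨G, F, hne, fun b => hG _, hF⟩

/-- The reflection exchanging the L-shaped paths of dimensions `w, h` and `h, w`. -/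
def reflect (w h : ℕ) : Pos ≃ Pos where
  toFun v := (h - v.2, w - v.1)
  invFun v := (w - v.2, h - v.1)
  left_inv v := by simp
  right_inv v := by simp

theorem reflect_add_dir (w h : ℕ) (v : Pos) (i : Fin 4) :
    reflect w h (v + dir i) = reflect w h v + dir (Fin.rev i) := by
  fin_cases i <;> ext <;> simp [reflect, dir, Fin.rev] <;> ring

theorem reflect_mem_lPath {w h : ℕ} {v : Pos} :
    reflect w h v ∈ lPath h w ↔ v ∈ lPath w h := by
  simp only [reflect, Equiv.coe_fn_mk, mem_lPath]
  omega

/-- The reflection of a configuration. -/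
def Configuration.reflect (C : Configuration) (w h : ℕ) : Configuration where
  cells := C.cells.map (FSSP.reflect w h).toEmbedding
  gen := FSSP.reflect w h C.gen
  gen_mem := by simp [C.gen_mem]

theorem Configuration.reflect_cells {C : Configuration} {w h : ℕ} (hC : C.cells = lPath w h) :
    (C.reflect w h).cells = lPath h w := by
  ext v
  obtain ⟨u, rfl⟩ := (FSSP.reflect w h).surjective v
  simp [Configuration.reflect, hC, reflect_mem_lPath]

theorem Automaton.flip_st (A : Automaton) (C : Configuration) (w h t : ℕ) (v : Pos) :
    A.flip.st (C.reflect w h) t (reflect w h v) = A.st C t v := by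
  have hmem : ∀ (u : Pos) (i : Fin 4),
      reflect w h u + dir (Fin.rev i) ∈ (C.reflect w h).cells ↔ u + dir i ∈ C.cells := by
    intro u i
    rw [← reflect_add_dir]
    simp [Configuration.reflect]
  induction t generalizing v with
  | zero =>
    have hbc : (C.reflect w h).bc (C.reflect w h).gen ∘ Fin.rev = C.bc C.gen := by
      funext i
      simp only [Function.comp, Configuration.bc, decide_eq_decide]
      exact hmem C.gen i
    by_cases hv : v = C.gen
    · subst hv
      have h1 : reflect w h C.gen = (C.reflect w h).gen := rfl
      simp only [Automaton.st, if_pos h1, if_pos]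
      simp only [Automaton.flip]
      rw [hbc]
    · have h1 : reflect w h v ≠ (C.reflect w h).gen := by
        simpa [Configuration.reflect] using hv
      simp only [Automaton.st, if_neg h1, if_neg hv]
      rfl
  | succ t ih =>
    simp only [Automaton.st]
    rw [ih]
    simp only [Automaton.flip]
    congr 1
    funext i
    simp only [Function.comp]
    by_cases hm : v + dir i ∈ C.cells
    · rw [if_pos hm, if_pos ((hmem v i).2 hm), ← reflect_add_dir]
      exact congrArg some (ih _)
    · rw [if_neg hm, if_neg (fun h => hm ((hmem v i).1 h))]

theorem Automaton.flip_firesAt {A : Automaton} {C : Configuration} {w h t : ℕ} :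
    A.flip.FiresAt (C.reflect w h) t ↔ A.FiresAt C t := by
  have hcells : ∀ p : Pos → Prop, (∀ v ∈ (C.reflect w h).cells, p v) ↔
      ∀ v ∈ C.cells, p (FSSP.reflect w h v) := by
    intro p
    exact Finset.forall_mem_map
  simp only [Automaton.FiresAt, hcells, flip_st]
  rfl

theorem Configuration.reflect_reflect (C : Configuration) (w h : ℕ) :
    (C.reflect w h).reflect h w = C := by
  have hinv : ∀ v, FSSP.reflect h w (FSSP.reflect w h v) = v := fun v => by simp [FSSP.reflect]
  apply Configuration.eq_of_cells_of_gen
  · ext v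
    simp only [Configuration.reflect, Finset.mem_map, Equiv.coe_toEmbedding,
      exists_exists_and_eq_and, hinv, exists_eq_right]
  · exact hinv _

theorem IsSolution.flip {M : Model} {a b : ℕ} {A : Automaton} (hA : IsSolution M (gLSP a b) A) :
    IsSolution M (gLSP b a) A.flip := by
  refine ⟨hA.1.flip, fun C ⟨l, hl, hC⟩ => ?_⟩
  obtain ⟨t, ht⟩ := hA.2 (C.reflect (b * l) (a * l)) ⟨l, hl, Configuration.reflect_cells hC⟩
  refine ⟨t, ?_⟩
  rw [← C.reflect_reflect (b * l) (a * l)]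
  exact Automaton.flip_firesAt.2 ht

/-! ### The wave of the general runs freely behind the corner -/

/-- Strictly between the corner and the north terminal all nodes have the same boundary condition,
so the dynamics there is invariant under translation along the arm. -/
theorem Automaton.st_lNode_succ (A : Automaton) {w h i : ℕ} (t : ℕ) (hi : w ≤ i)
    (hh : i + 1 < w + h) :
    A.st (lConf w h) (t + 1) (lNode w (i + 1)) = A.next (A.st (lConf w h) t (lNode w (i + 1)))
      ![none, some (A.st (lConf w h) t (lNode w (i + 2))), none,
        some (A.st (lConf w h) t (lNode w i))] := by
  have h0 : lNode w (i + 1) + dir 0 ∉ lPath w h := by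
    simp [mem_lPath, dir, lNode]; omega
  have h2 : lNode w (i + 1) + dir 2 ∉ lPath w h := by
    simp [mem_lPath, dir, lNode]; omega
  have h1 : lNode w (i + 1) + dir 1 = lNode w (i + 2) := by
    ext <;> simp [dir, lNode] <;> omega
  have h3 : lNode w (i + 1) + dir 3 = lNode w i := by
    ext <;> simp [dir, lNode] <;> omega
  have m1 : lNode w (i + 2) ∈ lPath w h := lNode_mem (by omega)
  have m3 : lNode w i ∈ lPath w h := lNode_mem (by omega)
  rw [Automaton.st]
  congr 1
  funext j
  change (if _ ∈ lPath w h then _ else _) = _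
  fin_cases j
  · exact if_neg h0
  · exact (if_pos (h1 ▸ m1)).trans (congrArg (fun u => some (A.st (lConf w h) t u)) h1)
  · exact if_neg h2
  · exact (if_pos (h3 ▸ m3)).trans (congrArg (fun u => some (A.st (lConf w h) t u)) h3)

/-- If the four cells behind the front of the wave look the same at times `n` and `n + r`, then
the computation repeats with period `r` until the reflection at the north terminal interferes. -/
theorem Automaton.st_lNode_periodic (A : Automaton) {w h n r : ℕ} (hn : w + 3 ≤ n)
    (hwin : ∀ j ≤ 3, A.st (lConf w h) n (lNode w (n - j)) =
      A.st (lConf w h) (n + r) (lNode w (n + r - j)))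
    (s i : ℕ) (hi : n + s ≤ i + 3) (hend : i + r + (n + r + s) < 2 * (w + h)) :
    A.st (lConf w h) (n + s) (lNode w i) = A.st (lConf w h) (n + r + s) (lNode w (i + r)) := by
  induction s generalizing i with
  | zero =>
    rcases Nat.lt_or_ge n i with hlt | hge
    · rw [A.st_lNode_eq_quiescent w h (by omega), A.st_lNode_eq_quiescent w h (by omega)]
    · have := hwin (n - i) (by omega)
      rwa [show n - (n - i) = i by omega, show n + r - (n - i) = i + r by omega] at this
  | succ s ih =>
    rcases Nat.lt_or_ge (n + (s + 1)) i with hlt | hge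
    · rw [A.st_lNode_eq_quiescent w h (by omega), A.st_lNode_eq_quiescent w h (by omega)]
    -- The rear edge of the window also moves at unit speed, so the southern neighbor k was still in
    -- the window one step earlier. The terminal can only affect points whose position and time add
    -- up to at least 2(w + h), which `hend` excludes.
    · obtain ⟨k, rfl⟩ : ∃ k, i = k + 1 := ⟨i - 1, by omega⟩
      rw [← add_assoc, ← add_assoc, A.st_lNode_succ _ (by omega) (by omega),
        show k + 1 + r = k + r + 1 by omega, A.st_lNode_succ _ (by omega) (by omega),
        ih k (by omega) (by omega), ih (k + 1) (by omega) (by omega),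
        ih (k + 2) (by omega) (by omega), show k + 1 + r = k + r + 1 by omega,
        show k + 2 + r = k + r + 2 by omega]

/-- With the general at the west terminal, no automaton fires all long L-shaped paths as soon as
one step after the wave of the general has reached the north terminal. -/
theorem Automaton.lt_of_firesAt (A : Automaton) {w h t : ℕ}
    (hh : Nat.card (Fin 4 → A.State) + 4 ≤ h) (ht : A.FiresAt (lConf w h) t) :
    w + h + 1 < t := by
  by_contra! hle
  have := A.finite
  have := Fintype.ofFinite (Fin 4 → A.State)
  have hge : w + h ≤ t := by
    by_contra! hlt
    have h1 := ht.2 (lNode w (w + h)) (lNode_mem le_rfl)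
    rw [A.st_lNode_eq_quiescent w h hlt] at h1
    exact A.quiescent_notMem_firing h1
  -- Pigeonhole on the windows at times w + 3 + x: the 3 keeps all four cells from lying before the
  -- corner, and the bound on h makes all these times at most t.
  obtain ⟨x, y, hxy, hf⟩ := Fintype.exists_ne_map_eq_of_card_lt
    (fun (x : Fin (Nat.card (Fin 4 → A.State) + 1)) (j : Fin 4) =>
      A.st (lConf w h) (w + 3 + x) (lNode w (w + 3 + x - j))) (by
        rw [Fintype.card_fin, Nat.card_eq_fintype_card]; exact Nat.lt_succ_self _)
  wlog hlt : x < y generalizing x y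
  · exact this y x hxy.symm hf.symm (lt_of_le_of_ne (not_lt.1 hlt) hxy.symm)
  obtain ⟨r, hr⟩ : ∃ r, (y : ℕ) = x + r := ⟨y - x, by omega⟩
  obtain ⟨s, hs⟩ : ∃ s, t = w + 3 + x + r + s := ⟨t - (w + 3 + x + r), by omega⟩
  have hr0 : 0 < r := by
    have : (x : ℕ) < y := hlt
    omega
  -- At time t, the node 2(w + h) - 1 - t is the northernmost one free of the terminal's influence.
  -- For t = w + h + 1 it is the node t - 3, which is why the window has four cells.
  have hper := A.st_lNode_periodic (w := w) (h := h) (n := w + 3 + x) (r := r) (by omega)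
    (fun j hj => by
      have := congrFun hf ⟨j, by omega⟩
      simp only [hr] at this
      rwa [← add_assoc] at this)
    s (2 * (w + h) - 1 - t - r) (by omega) (by omega)
  rw [← hs] at hper
  refine ht.1 (w + 3 + x + s) (by omega) _ (lNode_mem (by omega)) (hper ▸ ht.2 _ (lNode_mem ?_))
  omega

/-! ### An automaton recognizing one L-shaped path -/

/-- States of the scouting automaton: a clock that stops at `T + 1`, and two flags, telling that
the general is at the west terminal and that the corner is at a given distance from it. -/
abbrev ScoutState (T : ℕ) : Type := Option (Fin (T + 2) × Prop × Prop)

/-- `x` is the state of the node itself or of one of its neighbors. -/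
def ScoutState.Visible {T : ℕ} (s : ScoutState T) (inputs : Fin 4 → Option (ScoutState T))
    (x : Fin (T + 2) × Prop × Prop) : Prop :=
  s = some x ∨ ∃ i, inputs i = some (some x)

/-- The value of the clock at time `t`. -/
def scoutClock (T t : ℕ) : Fin (T + 2) := ⟨min t (T + 1), by omega⟩

open Classical in
/-- The transition function of the scouting automaton. -/
noncomputable def scoutNext (T w : ℕ) (s : ScoutState T)
    (inputs : Fin 4 → Option (ScoutState T)) : ScoutState T :=
  if hx : ∃ x, s.Visible inputs x then
    some (scoutClock T (hx.choose.1 + 1),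
      (∃ x, s.Visible inputs x ∧ x.2.1) ∨
        ((∃ x, s = some x ∧ x.1 = scoutClock T 0) ∧ ∀ i, (inputs i).isSome ↔ i = 0),
      (∃ x, s.Visible inputs x ∧ x.2.2) ∨
        (s = none ∧ scoutClock T (hx.choose.1 + 1) = scoutClock T w ∧
          ∀ i, (inputs i).isSome ↔ i = 1 ∨ i = 2))
  else none

/-- The automaton in which a node fires at time `T` if it knows by then that the general is at the
west terminal and that the corner is at distance `w` from it. -/
noncomputable def scout (T w : ℕ) : Automaton where
  State := ScoutState T
  finite := by
    have : Finite (Fin (T + 2) × Prop × Prop) := inferInstance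
    infer_instance
  quiescent := none
  general _ := some (scoutClock T 0, False, False)
  firing := {s | ∃ x, s = some x ∧ x.1 = scoutClock T T ∧ x.2.1 ∧ x.2.2}
  next := scoutNext T w
  next_quiescent inputs h := by
    rw [scoutNext, dif_neg]
    rintro ⟨x, hx | ⟨i, hi⟩⟩
    · simp at hx
    · rcases h i with h | h <;> simp [h] at hi
  general_ne_quiescent _ := Option.some_ne_none _
  quiescent_notMem_firing := by simp

/-- The states of the scouting automaton. -/
noncomputable def scoutSt (T w : ℕ) (C : Configuration) (t : ℕ) (v : Pos) : ScoutState T :=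
  (scout T w).st C t v

section

variable {T w : ℕ} {C : Configuration} {t : ℕ} {v : Pos}

theorem scoutSt_zero : scoutSt T w C 0 v =
    if v = C.gen then some (scoutClock T 0, False, False) else none := rfl

theorem scoutSt_zero_eq_some {x} (h : scoutSt T w C 0 v = some x) :
    v = C.gen ∧ x = (scoutClock T 0, False, False) := by
  rw [scoutSt_zero] at h
  split_ifs at h with hv
  exact ⟨hv, (Option.some.inj h).symm⟩

/-- The inputs of `v` at time `t`. -/
noncomputable def scoutInputs (T w : ℕ) (C : Configuration) (t : ℕ) (v : Pos) :
    Fin 4 → Option (ScoutState T) :=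
  fun i => if v + dir i ∈ C.cells then some (scoutSt T w C t (v + dir i)) else none

theorem scoutSt_succ : scoutSt T w C (t + 1) v =
    scoutNext T w (scoutSt T w C t v) (scoutInputs T w C t v) := rfl

theorem scoutInputs_isSome (i : Fin 4) :
    (scoutInputs T w C t v i).isSome ↔ v + dir i ∈ C.cells := by
  unfold scoutInputs
  split_ifs with h <;> simp [h]

theorem exists_of_visible {x}
    (h : (scoutSt T w C t v).Visible (scoutInputs T w C t v) x) :
    ∃ u, scoutSt T w C t u = some x := by
  rcases h with h | ⟨i, hi⟩
  · exact ⟨v, h⟩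
  · unfold scoutInputs at hi
    split_ifs at hi
    exact ⟨_, Option.some.inj hi⟩

theorem scoutNext_eq_some {s : ScoutState T} {inputs x} (h : scoutNext T w s inputs = some x) :
    ∃ y, s.Visible inputs y ∧ x = (scoutClock T (y.1 + 1),
      (∃ x, s.Visible inputs x ∧ x.2.1) ∨
        ((∃ x, s = some x ∧ x.1 = scoutClock T 0) ∧ ∀ i, (inputs i).isSome ↔ i = 0),
      (∃ x, s.Visible inputs x ∧ x.2.2) ∨
        (s = none ∧ scoutClock T (y.1 + 1) = scoutClock T w ∧
          ∀ i, (inputs i).isSome ↔ i = 1 ∨ i = 2)) := by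
  unfold scoutNext at h
  split_ifs at h with hx
  exact ⟨_, hx.choose_spec, (Option.some.inj h).symm⟩

/-- All awake nodes show the same time, so the arbitrary choice of a visible clock in `scoutNext` is
harmless. -/
theorem scoutClock_eq {x} (h : scoutSt T w C t v = some x) : x.1 = scoutClock T t := by
  induction t generalizing v x with
  | zero => rw [(scoutSt_zero_eq_some h).2]
  | succ t ih =>
    rw [scoutSt_succ] at h
    obtain ⟨y, hy, rfl⟩ := scoutNext_eq_some h
    obtain ⟨u, hu⟩ := exists_of_visible hy
    simp only [ih hu]
    simp only [scoutClock, Fin.mk.injEq]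
    omega

theorem scoutSt_succ_eq_some {x} (h : scoutSt T w C (t + 1) v = some x) :
    x = (scoutClock T (t + 1),
      (∃ x, (scoutSt T w C t v).Visible (scoutInputs T w C t v) x ∧ x.2.1) ∨
        ((∃ x, scoutSt T w C t v = some x ∧ x.1 = scoutClock T 0) ∧
          ∀ i, v + dir i ∈ C.cells ↔ i = 0),
      (∃ x, (scoutSt T w C t v).Visible (scoutInputs T w C t v) x ∧ x.2.2) ∨
        (scoutSt T w C t v = none ∧ scoutClock T (t + 1) = scoutClock T w ∧
          ∀ i, v + dir i ∈ C.cells ↔ i = 1 ∨ i = 2)) := by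
  have hc := scoutClock_eq h
  rw [scoutSt_succ] at h
  obtain ⟨y, hy, hx⟩ := scoutNext_eq_some h
  have hc' : scoutClock T (y.1 + 1) = scoutClock T (t + 1) := by rw [← hc, hx]
  rw [hx, hc']
  simp only [scoutInputs_isSome]

theorem scoutSt_succ_ne_none {x}
    (h : (scoutSt T w C t v).Visible (scoutInputs T w C t v) x) :
    ∃ y, scoutSt T w C (t + 1) v = some y := by
  rw [scoutSt_succ, scoutNext, dif_pos ⟨x, h⟩]
  exact ⟨_, rfl⟩

theorem bc_gen_of_flag {x} (h : scoutSt T w C t v = some x) (hx : x.2.1) (i : Fin 4) :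
    C.gen + dir i ∈ C.cells ↔ i = 0 := by
  induction t generalizing v x with
  | zero => simp [(scoutSt_zero_eq_some h).2] at hx
  | succ t ih =>
    rw [scoutSt_succ_eq_some h] at hx
    rcases hx with ⟨y, hy, hy1⟩ | ⟨⟨y, hy, hy0⟩, hb⟩
    · obtain ⟨u, hu⟩ := exists_of_visible hy
      exact ih hu hy1
    · rw [scoutClock_eq hy] at hy0
      simp only [scoutClock, Fin.mk.injEq] at hy0
      obtain rfl : t = 0 := by omega
      rw [← (scoutSt_zero_eq_some hy).1]
      exact hb i

/-- Every corner flag can be traced back to a node that saw itself to be the corner while waking up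
at time w. Since w ≤ T, the saturating clock identifies this time exactly. -/
theorem corner_of_flag (hw : 0 < w) (hwT : w ≤ T) {x} (h : scoutSt T w C t v = some x)
    (hx : x.2.2) : ∃ u, (∀ i, u + dir i ∈ C.cells ↔ i = 1 ∨ i = 2) ∧
      scoutSt T w C (w - 1) u = none ∧ scoutSt T w C w u ≠ none := by
  induction t generalizing v x with
  | zero => simp [(scoutSt_zero_eq_some h).2] at hx
  | succ t ih =>
    have h' := h
    rw [scoutSt_succ_eq_some h] at hx
    rcases hx with ⟨y, hy, hy1⟩ | ⟨hn, hc, hb⟩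
    · obtain ⟨u, hu⟩ := exists_of_visible hy
      exact ih hu hy1
    · simp only [scoutClock, Fin.mk.injEq] at hc
      obtain rfl : w = t + 1 := by omega
      exact ⟨v, hb, hn, by simp [h']⟩

/-- Persistent and contagious properties of the states of the scouting automaton. -/
theorem scout_spread {W h : ℕ} {p : Fin (T + 2) × Prop × Prop → Prop}
    (hp : ∀ t v x, (scoutSt T w (lConf W h) t v).Visible (scoutInputs T w (lConf W h) t v) x →
      p x → ∃ y, scoutSt T w (lConf W h) (t + 1) v = some y ∧ p y)
    {t₀ i₀ : ℕ} (h₀ : ∃ x, scoutSt T w (lConf W h) t₀ (lNode W i₀) = some x ∧ p x)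
    (hi₀ : i₀ ≤ W + h) {t i : ℕ} (hi : i ≤ W + h)
    (hle : t₀ + i ≤ t + i₀) (hge : t₀ + i₀ ≤ t + i) :
    ∃ x, scoutSt T w (lConf W h) t (lNode W i) = some x ∧ p x := by
  refine spread (P := fun t v => ∃ x, scoutSt T w (lConf W h) t v = some x ∧ p x)
    ?_ ?_ h₀ hi₀ hi hle hge
  · rintro t v ⟨x, hx, hpx⟩
    exact hp t v x (Or.inl hx) hpx
  · rintro t v d hd ⟨x, hx, hpx⟩
    refine hp t v x (Or.inr ⟨d, ?_⟩) hpx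
    rw [scoutInputs, ← hx]
    exact if_pos hd

theorem scoutSt_zero_west (W h : ℕ) : scoutSt T w (lConf W h) 0 (lNode W 0) =
    some (scoutClock T 0, False, False) := by
  rw [scoutSt_zero, if_pos]
  simp [lNode, lConf]

theorem scout_awake {W h i : ℕ} (hi : i ≤ W + h) (hit : i ≤ t) :
    ∃ x, scoutSt T w (lConf W h) t (lNode W i) = some x := by
  obtain ⟨x, hx, -⟩ := scout_spread (T := T) (w := w) (W := W) (h := h) (p := fun _ => True)
    (fun t v x hx _ => by simpa using scoutSt_succ_ne_none hx) (t₀ := 0) (i₀ := 0)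
    ⟨_, scoutSt_zero_west W h, trivial⟩ (Nat.zero_le _) hi (t := t) (by omega) (by omega)
  exact ⟨x, hx⟩

theorem scout_asleep {W h i : ℕ} (hit : t < i) :
    scoutSt T w (lConf W h) t (lNode W i) = none :=
  (scout T w).st_lNode_eq_quiescent W h hit

/-- The initial state of `scout` ignores the boundary condition, so the flag is raised only at time
1. This delay accounts for the extra step in w + h + 1. -/
theorem scout_flag_west {W h i : ℕ} (hW : 0 < W) (hi : i ≤ W + h) (hit : i + 1 ≤ t) :
    ∃ x, scoutSt T w (lConf W h) t (lNode W i) = some x ∧ x.2.1 := by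
  refine scout_spread (t₀ := 1) (i₀ := 0) (p := fun x => x.2.1) ?_ ?_ (Nat.zero_le _) hi
    (by omega) (by omega)
  · intro t v x hx hpx
    obtain ⟨y, hy⟩ := scoutSt_succ_ne_none hx
    refine ⟨y, hy, ?_⟩
    rw [scoutSt_succ_eq_some hy]
    exact Or.inl ⟨x, hx, hpx⟩
  · obtain ⟨x, hx⟩ := scout_awake (T := T) (w := w) (W := W) (h := h) (t := 1) (i := 0)
      (Nat.zero_le _) (Nat.zero_le _)
    refine ⟨x, hx, ?_⟩
    rw [scoutSt_succ_eq_some hx]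
    refine Or.inr ⟨⟨_, scoutSt_zero_west W h, rfl⟩, fun i => ?_⟩
    have : lNode W 0 = (0, 0) := by simp [lNode]
    rw [this]
    exact lConf_bc_gen hW i

/-- The flag is raised at the corner at time w and spreads both ways, reaching a node i < w on the
way back at time 2w - i. -/
theorem scout_flag_corner {h i : ℕ} (hw : 0 < w) (hh : 0 < h) (hi : i ≤ w + h)
    (hit : i ≤ t) (hit' : 2 * w ≤ t + i) :
    ∃ x, scoutSt T w (lConf w h) t (lNode w i) = some x ∧ x.2.2 := by
  refine scout_spread (t₀ := w) (i₀ := w) (p := fun x => x.2.2) ?_ ?_ (Nat.le_add_right _ _) hi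
    (by omega) (by omega)
  · intro t v x hx hpx
    obtain ⟨y, hy⟩ := scoutSt_succ_ne_none hx
    refine ⟨y, hy, ?_⟩
    rw [scoutSt_succ_eq_some hy]
    exact Or.inl ⟨x, hx, hpx⟩
  · obtain ⟨x, hx⟩ := scout_awake (T := T) (w := w) (W := w) (h := h) (t := w) (i := w)
      (Nat.le_add_right _ _) le_rfl
    refine ⟨x, hx, ?_⟩
    obtain ⟨k, hk⟩ : ∃ k, w = k + 1 := ⟨w - 1, by omega⟩
    have hx' : scoutSt T w (lConf w h) (k + 1) (lNode w w) = some x := by rw [← hk]; exact hx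
    rw [scoutSt_succ_eq_some hx']
    exact Or.inr ⟨scout_asleep (by omega), by rw [← hk], lConf_bc_corner hw hh⟩

end

/-- News of the corner returns to the west terminal at time 2w, which is at most w + h because w ≤
h. -/
theorem scout_firesAt {w h : ℕ} (hw : 0 < w) (hwh : w ≤ h) :
    ∀ v ∈ (lConf w h).cells,
      (scout (w + h + 1) w).st (lConf w h) (w + h + 1) v ∈ (scout (w + h + 1) w).firing := by
  intro v hv
  obtain ⟨i, hi, rfl⟩ := exists_lNode_eq hv
  obtain ⟨x, hx, hx1⟩ := scout_flag_west (T := w + h + 1) (w := w) (t := w + h + 1) hw hi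
    (by omega)
  obtain ⟨y, hy, hy2⟩ := scout_flag_corner (T := w + h + 1) (t := w + h + 1) hw
    (by omega) hi (by omega) (by omega)
  obtain rfl : x = y := Option.some.inj (hx.symm.trans hy)
  exact ⟨x, hx, scoutClock_eq hx, hx1, hy2⟩

/-- The flags never lie: the first one places the general at the west terminal, whose wave wakes the
corner at time W exactly, and the second one then forces W = w. -/
theorem eq_lConf_of_scout_firing {w T W h t : ℕ} (hw : 0 < w) (hwT : w ≤ T) {C : Configuration}
    (hC : C.cells = lPath W h) {v : Pos} (hv : (scout T w).st C t v ∈ (scout T w).firing) :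
    W = w ∧ C = lConf W h ∧ t ≥ T := by
  obtain ⟨x, hx, hx0, hx1, hx2⟩ := hv
  change scoutSt T w C t v = some x at hx
  have hgen : C.gen = (0, 0) := by
    refine eq_zero_of_bc_east (w := W) (h := h) (hC ▸ C.gen_mem) fun i => ?_
    rw [← hC]
    exact bc_gen_of_flag hx hx1 i
  obtain rfl : C = lConf W h := Configuration.eq_of_cells_of_gen hC hgen
  obtain ⟨u, hu, hu0, hu1⟩ := corner_of_flag hw hwT hx hx2
  obtain rfl : u = lNode W W := by
    rw [eq_corner_of_bc hu]
    simp [lNode]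
  refine ⟨?_, rfl, ?_⟩
  · apply le_antisymm
    · by_contra! hlt
      exact hu1 (scout_asleep hlt)
    · by_contra! hlt
      obtain ⟨y, hy⟩ := scout_awake (T := T) (w := w) (W := W) (h := h) (t := w - 1) (i := W)
        (Nat.le_add_right _ _) (by omega)
      simp [hy] at hu0
  -- The clock saturates at T + 1 rather than at T, so it cannot show T at any time other than T.
  · rw [scoutClock_eq hx] at hx0
    simp only [scoutClock, Fin.mk.injEq] at hx0
    omega

/-- If the horizontal arm is not longer than the vertical one, each L-shaped path with the general
at the west terminal can be fired one step after the wave of the general has reached the north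
terminal, provided that there is a solution at all. -/
theorem IsSolution.exists_ft_le {M : Model} {a b : ℕ} (ha : 0 < a) (hab : a ≤ b) {A : Automaton}
    (hA : IsSolution M (gLSP a b) A) {l : ℕ} (hl : 1 ≤ l) :
    ∃ A', IsSolution M (gLSP a b) A' ∧
      ∃ t ≤ a * l + b * l + 1, A'.FiresAt (lConf (a * l) (b * l)) t := by
  have hw : 0 < a * l := Nat.mul_pos ha hl
  have hwh : a * l ≤ b * l := Nat.mul_le_mul_right l hab
  have hwT : a * l ≤ a * l + b * l + 1 := by omega
  set B := scout (a * l + b * l + 1) (a * l)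
  have hfire : ∀ t, A.FiresAt (lConf (a * l) (b * l)) t →
      (A.race B).FiresAt (lConf (a * l) (b * l)) (min t (a * l + b * l + 1)) := by
    intro t ht
    refine Automaton.race_firesAt (fun s hs v hv => ⟨ht.1 s (by omega) v hv, fun hf => ?_⟩)
      fun v hv => ?_
    · have := (eq_lConf_of_scout_firing hw hwT rfl hf).2.2
      omega
    · rcases le_total t (a * l + b * l + 1) with h | h
      · rw [min_eq_left h]
        exact Or.inl (ht.2 v hv)
      · rw [min_eq_right h]
        exact Or.inr (scout_firesAt hw hwh v hv)
  refine ⟨A.race B, ⟨hA.1.race ⟨_, ?_, fun _ => rfl⟩, ?_⟩, ?_⟩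
  · rintro ⟨x, hx, -, hx1, -⟩
    obtain rfl := Option.some.inj hx
    exact hx1
  · rintro C ⟨m, hm, hC⟩
    obtain ⟨t, ht⟩ := hA.2 C ⟨m, hm, hC⟩
    by_cases hcl : C = lConf (a * l) (b * l)
    · subst hcl
      exact ⟨_, hfire t ht⟩
    · refine ⟨t, Automaton.race_firesAt (fun s hs v hv => ⟨ht.1 s hs v hv, fun hf => ?_⟩)
        fun v hv => Or.inl (ht.2 v hv)⟩
      obtain ⟨h1, h2, -⟩ := eq_lConf_of_scout_firing hw hwT hC hf
      -- Within the variation the horizontal arm alone determines the path.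
      obtain rfl : m = l := Nat.eq_of_mul_eq_mul_left ha h1
      exact hcl h2
  · obtain ⟨t, ht⟩ := hA.2 (lConf (a * l) (b * l)) ⟨l, hl, rfl⟩
    exact ⟨_, min_le_right _ _, hfire t ht⟩

/-! ### The contradiction for a minimal-time solution -/

theorem IsMinimalTimeSolution.firesAt {M : Model} {Γ : Variation} {A A' : Automaton}
    (hA : IsMinimalTimeSolution M Γ A) (hA' : IsSolution M Γ A') {C : Configuration} (hC : C ∈ Γ)
    {t : ℕ} (ht : A'.FiresAt C t) : ∃ s ≤ t, A.FiresAt C s := by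
  obtain ⟨s, hs⟩ := hA.1.2 C hC
  refine ⟨s, ?_, hs⟩
  rw [← hs.ft_eq, hA.2 C hC]
  exact Nat.sInf_le ⟨A', hA', ht.ft_eq⟩

/-- No automaton fires all paths of `g-LSP[a,b]` with the general at the west terminal as soon as
one step after its wave has reached the north terminal. -/
theorem not_forall_firesAt_le {a b : ℕ} (hb : 0 < b) (A : Automaton)
    (hA : ∀ l, 1 ≤ l → ∃ t ≤ a * l + b * l + 1, A.FiresAt (lConf (a * l) (b * l)) t) : False := by
  obtain ⟨t, hle, ht⟩ := hA (Nat.card (Fin 4 → A.State) + 4) (by omega)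
  exact absurd (A.lt_of_firesAt (Nat.le_mul_of_pos_left _ hb) ht) (by omega)

end FSSP

theorem mainTheorem1 (M : FSSP.Model) (a b : ℕ) (ha : 0 < a) (hb : 0 < b) :
    ¬ ∃ A : FSSP.Automaton, FSSP.IsMinimalTimeSolution M (FSSP.gLSP a b) A := by
  rintro ⟨A, hA⟩
  rcases le_total a b with hab | hab
  · refine FSSP.not_forall_firesAt_le (a := a) hb A fun l hl => ?_
    obtain ⟨A', hA', t, hle, ht⟩ := hA.1.exists_ft_le ha hab hl
    obtain ⟨s, hs, hfs⟩ := hA.firesAt hA' (C := FSSP.lConf (a * l) (b * l)) ⟨l, hl, rfl⟩ ht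
    exact ⟨s, hs.trans hle, hfs⟩
  -- The wave now has to start on the longer horizontal arm's opposite side: reflected back, these
  -- are paths with the general at the north terminal.
  · refine FSSP.not_forall_firesAt_le (a := b) ha A.flip fun l hl => ?_
    obtain ⟨A', hA', t, hle, ht⟩ := hA.1.flip.exists_ft_le hb hab hl
    obtain ⟨s, hs, hfs⟩ := hA.firesAt hA'.flip
      (C := (FSSP.lConf (b * l) (a * l)).reflect (b * l) (a * l))
      ⟨l, hl, FSSP.Configuration.reflect_cells rfl⟩ (FSSP.Automaton.flip_firesAt.2 ht)
    refine ⟨s, hs.trans hle, ?_⟩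
    rw [← (FSSP.lConf (b * l) (a * l)).reflect_reflect (b * l) (a * l)]
    exact FSSP.Automaton.flip_firesAt.2 hfs
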